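/- A *profinite structure* is a pair $(X,G)$, where $X$ is a profinite space (the inverse limit of a countable system of finite discrete spaces) and $G$ is a compact Polish group acting continuously and faithfully on $X$. It is *small* if for every $n\in\omega$ there are only countably many orbits of $G$ on $X^n$. A subset $D$ of $X^n$ is *$A$-closed*, for a finite $A\subseteq X$, if it is closed and $g[D]=D$ for all $g$ in the pointwise stabilizer $G_A$; it is *$*$-closed* if it is $A$-closed for some finite $A\subseteq X$. The topological imaginary extension $X^{teq}$ is the disjoint union of the topological sorts $X^n/E$ (with the quotient topology and the induced action of $G$), where $n\in\omega$ and $E$ ranges over all $\emptyset$-closed equivalence relations on $X^n$; $A$-closed and $*$-closed subsets of a sort, or of a finite product of sorts, are defined in the same way. A group $H$ is *$*$-closed in $X$* [*in $X^{teq}$*] if its underlying set is a $*$-closed subset of some $X^n$ [of some topological sort] and the graph of its operation is $*$-closed; $*$-closed rings are defined analogously, with the graphs of both addition and multiplication. Rings are associative, but not necessarily unital or commutative. A group is *solvable-by-finite* [*abelian-by-finite*] if it has a normal solvable [abelian] subgroup of finite index. A ring $S$ is *nilpotent* if for some $n\geq 1$ one has $r_1\cdots r_n=0$ for all $r_1,\dots,r_n\in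 S$, and *null* if $rs=0$ for all $r,s\in S$; a ring is *nilpotent-by-finite* [*null-by-finite*] if it has a two-sided ideal of finite index that is a nilpotent [null] ring. **Corollary.** Let $(X,G)$ be a small profinite structure. (i) If every group $*$-closed in $X$ is solvable-by-finite, then every ring $*$-closed in $X$ is nilpotent-by-finite. The same holds with $X^{teq}$ in place of $X$ in both the hypothesis and the conclusion. (ii) If every nilpotent group $*$-closed in $X$ is abelian-by-finite, then every ring $*$-closed in $X$ is null-by-finite. The same holds with $X^{teq}$ in place of $X$ in both the hypothesis and the conclusion. -/

import Mathlib

open scoped Pointwise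

namespace ProfStr

/-! ### Profinite structures -/

/-- A profinite structure `(X, G)`: `X` is a profinite space (the inverse limit of a countable
system of finite discrete spaces, that is, compact, Hausdorff, totally disconnected and second
countable) and `G` is a compact Polish group acting continuously and faithfully on `X`.
The stabilizers of points are then automatically closed. -/
class ProfiniteStructure (X G : Type*) [TopologicalSpace X] [Group G] [TopologicalSpace G]
    [MulAction G X] : Prop where
  compactSpace : CompactSpace X
  t2Space : T2Space X
  totallyDisconnectedSpace : TotallyDisconnectedSpace X
  secondCountableTopology : SecondCountableTopology X
  isTopologicalGroup : IsTopologicalGroup G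
  polishSpace_group : PolishSpace G
  compactSpace_group : CompactSpace G
  continuousSMul : ContinuousSMul G X
  faithfulSMul : FaithfulSMul G X

/-- `(X, G)` is small: for every `n`, there are only countably many orbits of `G` on `X ^ n`. -/
def IsSmall (X G : Type*) [Group G] [MulAction G X] : Prop :=
  ∀ n : ℕ, Countable (MulAction.orbitRel.Quotient G (Fin n → X))

/-- For a space `Y` on which `G` acts (such as `X ^ n`, a topological sort, or a product of these),
a subset `D` of `Y` is `A`-closed, where `A ⊆ X`, if it is closed and invariant over `A`:
the pointwise stabilizer of `A` is contained in the setwise stabilizer of `D`. -/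
def IsClosedOver (G : Type*) {X Y : Type*} [Group G] [MulAction G X] [MulAction G Y]
    [TopologicalSpace Y] (A : Set X) (D : Set Y) : Prop :=
  IsClosed D ∧ fixingSubgroup G A ≤ MulAction.stabilizer G D

/-- `D ⊆ Y` is `*`-closed if it is `A`-closed for some finite `A ⊆ X`. -/
def IsStarClosed (X G : Type*) {Y : Type*} [Group G] [MulAction G X] [MulAction G Y]
    [TopologicalSpace Y] (D : Set Y) : Prop :=
  ∃ A : Set X, A.Finite ∧ IsClosedOver G A D

/-! ### Topological sorts -/

/-- A `∅`-closed equivalence relation on `X ^ n`. -/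
structure ClosedEquiv (X G : Type*) [TopologicalSpace X] [Group G] [MulAction G X] (n : ℕ) where
  rel : Setoid (Fin n → X)
  closed : IsClosedOver G (∅ : Set X) {p : (Fin n → X) × (Fin n → X) | rel p.1 p.2}

variable {X G : Type*} [TopologicalSpace X] [Group G] [MulAction G X] {n : ℕ}

theorem ClosedEquiv.smul_rel (E : ClosedEquiv X G n) (g : G) {a b : Fin n → X}
    (h : E.rel a b) : E.rel (g • a) (g • b) := by
  have hg : g ∈ fixingSubgroup G (∅ : Set X) := by
    rw [mem_fixingSubgroup_iff]
    intro y hy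
    exact absurd hy (Set.notMem_empty y)
  have hs := MulAction.mem_stabilizer_iff.1 (E.closed.2 hg)
  have hab : g • (a, b) ∈ g • {p : (Fin n → X) × (Fin n → X) | E.rel p.1 p.2} :=
    Set.smul_mem_smul_set h
  rw [hs] at hab
  exact hab

/-- The topological sort `X ^ n / E`, with the quotient topology. The topological imaginary
extension `X^teq` is the disjoint union of all these sorts. -/
def TopSort (E : ClosedEquiv X G n) : Type _ := Quotient E.rel

instance (E : ClosedEquiv X G n) : TopologicalSpace (TopSort E) :=
  inferInstanceAs (TopologicalSpace (Quotient E.rel))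

/-- The action of `G` on a topological sort: `g • [a] = [g • a]`. -/
instance (E : ClosedEquiv X G n) : MulAction G (TopSort E) where
  smul g := Quotient.map (g • ·) (fun _ _ h => E.smul_rel g h)
  one_smul q := by
    induction q using Quotient.inductionOn with
    | h a => exact congrArg (Quotient.mk E.rel) (one_smul G a)
  mul_smul g k q := by
    induction q using Quotient.inductionOn with
    | h a => exact congrArg (Quotient.mk E.rel) (mul_smul g k a)

/-! ### `*`-closed groups and rings -/

/-- The graph of multiplication on a subset `H` of `Y`, as a subset of `Y × Y × Y`. -/
def mulGraph {Y : Type*} (H : Set Y) [Mul H] : Set (Y × Y × Y) :=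
  {p | ∃ a b : H, p = ((a : Y), (b : Y), ((a * b : H) : Y))}

/-- The graph of addition on a subset `R` of `Y`, as a subset of `Y × Y × Y`. -/
def addGraph {Y : Type*} (R : Set Y) [Add R] : Set (Y × Y × Y) :=
  {p | ∃ a b : R, p = ((a : Y), (b : Y), ((a + b : R) : Y))}

/-- A group with underlying set `H ⊆ Y` is `*`-closed if `H` and the group operation are. -/
def IsStarClosedGroup (X G : Type*) {Y : Type*} [Group G] [MulAction G X] [MulAction G Y]
    [TopologicalSpace Y] (H : Set Y) [Group H] : Prop :=
  IsStarClosed X G H ∧ IsStarClosed X G (mulGraph H)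

/-- A ring (associative, not necessarily unital or commutative) with underlying set `R ⊆ Y` is
`*`-closed if `R` and both ring operations are. -/
def IsStarClosedRing (X G : Type*) {Y : Type*} [Group G] [MulAction G X] [MulAction G Y]
    [TopologicalSpace Y] (R : Set Y) [NonUnitalRing R] : Prop :=
  IsStarClosed X G R ∧ IsStarClosed X G (addGraph R) ∧ IsStarClosed X G (mulGraph R)

/-! ### Algebraic properties -/

/-- A group is solvable-by-finite if it has a normal solvable subgroup of finite index. -/
def IsSolvableByFinite (H : Type*) [Group H] : Prop :=
  ∃ N : Subgroup H, N.Normal ∧ N.FiniteIndex ∧ Group.IsSolvable N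

/-- A group is abelian-by-finite if it has a normal abelian subgroup of finite index. -/
def IsAbelianByFinite (H : Type*) [Group H] : Prop :=
  ∃ N : Subgroup H, N.Normal ∧ N.FiniteIndex ∧ ∀ a b : N, a * b = b * a

/-- A ring is null if all products of two elements are zero. -/
def IsNullRing (S : Type*) [NonUnitalRing S] : Prop := ∀ a b : S, a * b = 0

/-- A ring is nilpotent if, for some `n`, all products `a * r₁ * ⋯ * rₙ` of `n + 1` elements
are zero. -/
def IsNilpotentRing (S : Type*) [NonUnitalRing S] : Prop :=
  ∃ n : ℕ, ∀ (a : S) (l : List S), l.length = n → l.foldl (· * ·) a = 0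

/-- A ring is null-by-finite if it has a null two-sided ideal `I` with `R / I` finite. -/
def IsNullByFiniteRing (R : Type*) [NonUnitalRing R] : Prop :=
  ∃ I : TwoSidedIdeal R, Finite I.ringCon.Quotient ∧ IsNullRing I

/-- A ring is nilpotent-by-finite if it has a nilpotent two-sided ideal `I` with `R / I` finite. -/
def IsNilpotentByFiniteRing (R : Type*) [NonUnitalRing R] : Prop :=
  ∃ I : TwoSidedIdeal R, Finite I.ringCon.Quotient ∧ IsNilpotentRing I

end ProfStr

/-!
The proof passes from a ring `R` to a group built from `R` whose entries are coordinates in `R`, so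
that the group is `*`-closed as soon as `R` is, and reads off an ideal of `R` from a subgroup of
finite index.

For nilpotency the group is `QuasiGL R`, the quasiregular matrices of size three over `R` under the
operation `A + B + A * B`. It contains the elementary matrices `1 + a e_ij`, and
`[1 + a e_ij, 1 + b e_jk] = 1 + a b e_ik` for distinct `i, j, k`. If `N` is a normal solvable
subgroup of finite index, this formula shows that the elements `a` with every `1 + a e_ij` in `N`
form a two-sided ideal of finite index (`levelIdeal`), and that elementary matrices of products of
`2 ^ m` elements of the ideal lie in the `m`-th derived subgroup of `N`
(`elementary_foldl_mem_derivedSeries`). Solvability of `N` makes these products vanish.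

For nullity the group is the Heisenberg group, which is nilpotent. If `N` is an abelian subgroup of
finite index, the elements `a` with `(a, 0, 0)` and `(0, a, 0)` in `N` form an additive subgroup of
finite index on which the product vanishes, again by a commutator computation. It is a subring, and
a subring of finite index contains a two-sided ideal of finite index (`exists_twoSidedIdeal_le`).

These groups are `*`-closed for topological reasons. The graphs of the ring operations are closed
and the sorts are compact, so `R` is a compact topological ring, and both groups are compact
topological groups; their images in a Hausdorff space are closed and so are the graphs of their
operations (`exists_isStarClosedGroup_range`). The pointwise stabilizer of the parameters acts on
`R`, hence on the groups, by endomorphisms, which gives invariance. Finally, powers of a sort embed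
in a single sort (`TopSort.exists_pow_embedding`), because the quotient of a compact Hausdorff space
by a closed equivalence relation is Hausdorff.
-/

namespace ProfStr

/-! ### Ideals of finite index -/

/-- Finiteness of `R / I` is tested by a map on `R`, not necessarily additive, into a finite type
whose fibres lie in cosets of `I`. -/
theorem finite_quotient_of_map {R F : Type*} [NonUnitalRing R] [Finite F] (I : TwoSidedIdeal R)
    (f : R → F) (hf : ∀ a b, f a = f b → a - b ∈ I) : Finite I.ringCon.Quotient := by
  refine Finite.of_injective (fun q : I.ringCon.Quotient => f (Quotient.out q)) fun p q h => ?_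
  rw [← Quotient.out_eq p, ← Quotient.out_eq q]
  exact Quotient.sound ((TwoSidedIdeal.rel_iff I _ _).2 (hf _ _ h))

/-- A subring `I` of finite additive index contains a two-sided ideal of finite index, namely the
set of `s` such that `s`, `s * r`, `r * s` and `r * s * r'` lie in `I` for all `r`, `r'`. It has
finite index because, `I` being a subring, it suffices to test `r` and `r'` in a finite set of
representatives of `R / I`. -/
theorem exists_twoSidedIdeal_le {R F : Type*} [NonUnitalRing R] [Finite F] (I : AddSubgroup R)
    (hmul : ∀ a ∈ I, ∀ b ∈ I, a * b ∈ I) (f : R → F) (hf : ∀ a b, f a = f b → a - b ∈ I) :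
    ∃ J : TwoSidedIdeal R, Finite J.ringCon.Quotient ∧ ∀ a ∈ J, a ∈ I := by
  have hfin : Finite (R ⧸ I) :=
    Finite.of_injective (fun q : R ⧸ I => f (Quotient.out q)) fun p q h => by
      rw [← Quotient.out_eq p, ← Quotient.out_eq q]
      refine QuotientAddGroup.eq.2 ?_
      rw [neg_add_eq_sub]
      exact hf _ _ h.symm
  let c : Set R := {s | s ∈ I ∧ (∀ r, s * r ∈ I) ∧ (∀ r, r * s ∈ I) ∧ ∀ r r', r * s * r' ∈ I}
  let J : TwoSidedIdeal R := .mk' c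
    (by simp [c, I.zero_mem])
    (by
      rintro x y ⟨h1, h2, h3, h4⟩ ⟨k1, k2, k3, k4⟩
      refine ⟨I.add_mem h1 k1, fun r => ?_, fun r => ?_, fun r r' => ?_⟩
      · rw [add_mul]; exact I.add_mem (h2 r) (k2 r)
      · rw [mul_add]; exact I.add_mem (h3 r) (k3 r)
      · rw [mul_add, add_mul]; exact I.add_mem (h4 r r') (k4 r r'))
    (by
      rintro x ⟨h1, h2, h3, h4⟩
      simpa [c, h1, neg_mul, mul_neg] using ⟨h2, h3, h4⟩)
    (by
      rintro x y ⟨h1, h2, h3, h4⟩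
      refine ⟨h3 x, h4 x, fun r => ?_, fun r r' => ?_⟩
      · rw [← mul_assoc]; exact h3 _
      · rw [← mul_assoc]; exact h4 _ _)
    (by
      rintro x y ⟨h1, h2, h3, h4⟩
      refine ⟨h2 y, fun r => ?_, fun r => ?_, fun r r' => ?_⟩
      · rw [mul_assoc]; exact h2 _
      · rw [← mul_assoc]; exact h4 _ _
      · rw [← mul_assoc, mul_assoc]; exact h4 _ _)
  have hJ : ∀ x, x ∈ J ↔ x ∈ c := fun x => TwoSidedIdeal.mem_mk' _ _ _ _ _ _ _
  refine ⟨J, ?_, fun a ha => ((hJ a).1 ha).1⟩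
  let m : R → R ⧸ I := fun r => (r : R ⧸ I)
  refine finite_quotient_of_map J
    (fun s => (m s, (fun q : R ⧸ I => m (s * q.out)), (fun q : R ⧸ I => m (q.out * s)),
      fun q q' : R ⧸ I => m (q.out * s * q'.out))) fun a b h => ?_
  simp only [Prod.mk.injEq, funext_iff] at h
  obtain ⟨h1, h2, h3, h4⟩ := h
  have key : ∀ x y, m x = m y → x - y ∈ I := fun x y hxy => by
    have := QuotientAddGroup.eq.1 hxy.symm
    rwa [neg_add_eq_sub] at this
  replace h1 := key _ _ h1
  replace h2 := fun q => key _ _ (h2 q)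
  replace h3 := fun q => key _ _ (h3 q)
  replace h4 := fun q q' => key _ _ (h4 q q')
  simp only [← sub_mul, ← mul_sub] at h2 h3 h4
  generalize a - b = d at h1 h2 h3 h4
  -- Modulo `I`, an arbitrary element may be replaced by the chosen representative of its coset.
  have hrep : ∀ r : R, ∃ i ∈ I, r = (m r).out + i := fun r =>
    ⟨r - (m r).out, key _ _ (Quotient.out_eq (m r)).symm, by abel⟩
  refine (hJ d).2 ⟨h1, fun r => ?_, fun r => ?_, fun r r' => ?_⟩
  · obtain ⟨i, hi, e⟩ := hrep r
    rw [e, mul_add]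
    exact I.add_mem (h2 _) (hmul _ h1 _ hi)
  · obtain ⟨i, hi, e⟩ := hrep r
    rw [e, add_mul]
    exact I.add_mem (h3 _) (hmul _ hi _ h1)
  · obtain ⟨i, hi, e⟩ := hrep r
    obtain ⟨i', hi', e'⟩ := hrep r'
    rw [e, e', add_mul, mul_add, add_mul, add_mul]
    refine I.add_mem (I.add_mem (h4 _ _) ?_) (I.add_mem (hmul _ (h3 _) _ hi') ?_)
    · rw [mul_assoc]; exact hmul _ hi _ (h2 _)
    · exact hmul _ (hmul _ hi _ h1) _ hi'

/-! ### The Heisenberg group of a ring -/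

/-- The Heisenberg group of a non-unital ring: the triple `(a, b, c)` stands for the upper
unitriangular matrix of size three with entries `a` and `b` above the diagonal and `c` in the
corner. -/
@[ext]
structure Heisenberg (R : Type*) where
  fst : R
  snd : R
  corner : R

namespace Heisenberg

variable {R : Type*} [NonUnitalRing R]

instance : Group (Heisenberg R) where
  mul x y := ⟨x.fst + y.fst, x.snd + y.snd, x.corner + y.corner + x.fst * y.snd⟩
  one := ⟨0, 0, 0⟩
  inv x := ⟨-x.fst, -x.snd, -x.corner + x.fst * x.snd⟩
  mul_assoc x y z := Heisenberg.ext (add_assoc _ _ _) (add_assoc _ _ _) (by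
    change x.corner + y.corner + x.fst * y.snd + z.corner + (x.fst + y.fst) * z.snd =
      x.corner + (y.corner + z.corner + y.fst * z.snd) + x.fst * (y.snd + z.snd)
    rw [add_mul, mul_add]; abel)
  one_mul x := Heisenberg.ext (zero_add _) (zero_add _) (by
    change 0 + x.corner + 0 * x.snd = x.corner
    simp)
  mul_one x := Heisenberg.ext (add_zero _) (add_zero _) (by
    change x.corner + 0 + x.fst * 0 = x.corner
    simp)
  inv_mul_cancel x := Heisenberg.ext (neg_add_cancel _) (neg_add_cancel _) (by
    change -x.corner + x.fst * x.snd + x.corner + -x.fst * x.snd = 0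
    rw [neg_mul]; abel)

theorem mul_def (x y : Heisenberg R) :
    x * y = ⟨x.fst + y.fst, x.snd + y.snd, x.corner + y.corner + x.fst * y.snd⟩ := rfl

theorem one_def : (1 : Heisenberg R) = ⟨0, 0, 0⟩ := rfl

/-- The projection `(a, b, c) ↦ (a, b)` of the Heisenberg group, whose kernel is central. -/
def proj (R : Type*) [NonUnitalRing R] : Heisenberg R →* Multiplicative (R × R) where
  toFun x := Multiplicative.ofAdd (x.fst, x.snd)
  map_one' := rfl
  map_mul' _ _ := rfl

/-- The Heisenberg group is a central extension of an abelian group. -/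
theorem isNilpotent : Group.IsNilpotent (Heisenberg R) := by
  refine Subgroup.isNilpotent_of_ker_le_center (proj R) (fun x hx => ?_)
  have h : (x.fst, x.snd) = ((0, 0) : R × R) := hx
  obtain ⟨h1, h2⟩ := Prod.mk.inj h
  refine Subgroup.mem_center_iff.2 fun y => ?_
  simp only [mul_def, h1, h2, zero_mul, mul_zero, Heisenberg.mk.injEq]
  exact ⟨by abel, by abel, by abel⟩

/-- If a subgroup `N` of finite index of the Heisenberg group is abelian, then the elements `a`
with `(a, 0, 0)` and `(0, a, 0)` in `N` form an additive subgroup of finite index, and the product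
of any two of them vanishes, being a corner entry of a commutator. -/
theorem isNullByFiniteRing (h : IsAbelianByFinite (Heisenberg R)) : IsNullByFiniteRing R := by
  obtain ⟨N, -, hN, hab⟩ := h
  let l : Multiplicative R →* Heisenberg R :=
    { toFun := fun a => ⟨a.toAdd, 0, 0⟩
      map_one' := rfl
      map_mul' := fun a b => by simp [mul_def] }
  let u : Multiplicative R →* Heisenberg R :=
    { toFun := fun a => ⟨0, a.toAdd, 0⟩
      map_one' := rfl
      map_mul' := fun a b => by simp [mul_def] }
  let I : AddSubgroup R := Subgroup.toAddSubgroup' (N.comap l ⊓ N.comap u)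
  have hI : ∀ a ∈ I, ∀ b ∈ I, a * b = 0 := by
    intro a ha b hb
    have := congrArg Subtype.val (hab ⟨_, ha.1⟩ ⟨_, hb.2⟩)
    have : (0 : R) + 0 + a * b = 0 + 0 + 0 * 0 := congrArg Heisenberg.corner this
    simpa only [add_zero, zero_add, mul_zero] using this
  have : Finite (Heisenberg R ⧸ N) := Subgroup.finite_quotient_of_finiteIndex
  obtain ⟨J, hJ, hJI⟩ := exists_twoSidedIdeal_le I
    (fun a ha b hb => by rw [hI a ha b hb]; exact I.zero_mem)
    (fun r => ((l (.ofAdd r) : Heisenberg R ⧸ N), (u (.ofAdd r) : Heisenberg R ⧸ N)))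
    (fun a b hab => by
      obtain ⟨h1, h2⟩ := Prod.mk.inj hab
      have e : Multiplicative.ofAdd (a - b) =
          (Multiplicative.ofAdd b)⁻¹ * Multiplicative.ofAdd a := by
        rw [← ofAdd_neg, ← ofAdd_add, neg_add_eq_sub]
      constructor
      · change l (Multiplicative.ofAdd (a - b)) ∈ N
        rw [e, map_mul, map_inv]; exact QuotientGroup.eq.1 h1.symm
      · change u (Multiplicative.ofAdd (a - b)) ∈ N
        rw [e, map_mul, map_inv]; exact QuotientGroup.eq.1 h2.symm)
  exact ⟨J, hJ, fun a b => Subtype.ext (hI _ (hJI _ a.2) _ (hJI _ b.2))⟩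

end Heisenberg

/-! ### Elementary matrices in the group of quasiregular matrices -/

section Elementary

/-- The group of quasiregular matrices of size three over `R`. A matrix `A` in it stands for
`1 + A`, so that the operation is `(A, B) ↦ A + B + A * B`, and `R` needs no unit. -/
abbrev QuasiGL (R : Type*) [NonUnitalRing R] : Type _ :=
  (PreQuasiregular (Matrix (Fin 3) (Fin 3) R))ˣ

theorem preQuasiregular_ext {R : Type*} {x y : PreQuasiregular R} (h : x.val = y.val) : x = y :=
  PreQuasiregular.equiv.symm.injective h

variable {R : Type*} [NonUnitalRing R]

open scoped commutatorElement

theorem quasiGL_ext {x y : QuasiGL R} (h : x.val.val = y.val.val) : x = y :=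
  Units.ext (preQuasiregular_ext h)

/-- The elementary matrix `1 + a e_ij`, for `i ≠ j`. -/
def elementary {i j : Fin 3} (hij : i ≠ j) (a : R) : QuasiGL R where
  val := ⟨Matrix.single i j a⟩
  inv := ⟨Matrix.single i j (-a)⟩
  val_inv := preQuasiregular_ext <| by
    simp [Matrix.single_mul_single_of_ne, hij.symm, ← Matrix.single_add]
  inv_val := preQuasiregular_ext <| by
    simp [Matrix.single_mul_single_of_ne, hij.symm, ← Matrix.single_add]

theorem elementary_add {i j : Fin 3} (hij : i ≠ j) (a b : R) :
    elementary hij (a + b) = elementary hij a * elementary hij b :=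
  quasiGL_ext <| by
    simp [elementary, Matrix.single_mul_single_of_ne, hij.symm, Matrix.single_add, add_comm]

theorem elementary_zero {i j : Fin 3} (hij : i ≠ j) : elementary hij (0 : R) = 1 :=
  quasiGL_ext <| by simp [elementary]

theorem elementary_neg {i j : Fin 3} (hij : i ≠ j) (a : R) :
    elementary hij (-a) = (elementary hij a)⁻¹ :=
  eq_inv_of_mul_eq_one_left <| by rw [← elementary_add, neg_add_cancel, elementary_zero]

theorem commutatorElement_elementary {i j k : Fin 3} (hij : i ≠ j) (hjk : j ≠ k) (hik : i ≠ k)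
    (a b : R) : ⁅elementary hij a, elementary hjk b⁆ = elementary hik (a * b) := by
  rw [commutatorElement_def, mul_inv_eq_iff_eq_mul, mul_inv_eq_iff_eq_mul, mul_assoc]
  refine quasiGL_ext ?_
  simp [elementary, Matrix.single_mul_single_of_ne, Matrix.single_mul_single_same, mul_add,
    hjk.symm, hik.symm]
  abel

theorem exists_third (i k : Fin 3) : ∃ j, i ≠ j ∧ j ≠ k := by
  revert i k; decide

/-- The elements all of whose elementary matrices lie in a normal subgroup `N` form a two-sided
ideal: the commutator formula turns normality of `N` into closure under multiplication by
arbitrary ring elements. -/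
def levelIdeal (N : Subgroup (QuasiGL R)) [N.Normal] : TwoSidedIdeal R :=
  .mk' {a | ∀ (i j : Fin 3) (hij : i ≠ j), elementary hij a ∈ N}
    (fun i j hij => by rw [elementary_zero]; exact N.one_mem)
    (fun hx hy i j hij => by rw [elementary_add]; exact N.mul_mem (hx i j hij) (hy i j hij))
    (fun hx i j hij => by rw [elementary_neg]; exact N.inv_mem (hx i j hij))
    (fun {x y} hy i k hik => by
      obtain ⟨j, hij, hjk⟩ := exists_third i k
      rw [← commutatorElement_elementary hij hjk hik]
      exact Subgroup.commutator_le_right ⊤ N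
        (Subgroup.commutator_mem_commutator (Subgroup.mem_top _) (hy j k hjk)))
    (fun {x y} hx i k hik => by
      obtain ⟨j, hij, hjk⟩ := exists_third i k
      rw [← commutatorElement_elementary hij hjk hik]
      exact Subgroup.commutator_le_left N ⊤
        (Subgroup.commutator_mem_commutator (hx i j hij) (Subgroup.mem_top _)))

theorem mem_levelIdeal {N : Subgroup (QuasiGL R)} [N.Normal] {a : R} :
    a ∈ levelIdeal N ↔ ∀ (i j : Fin 3) (hij : i ≠ j), elementary hij a ∈ N :=
  TwoSidedIdeal.mem_mk' _ _ _ _ _ _ _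

/-- Commutators of elementary matrices multiply entries, so the `m`-th derived subgroup contains
the elementary matrices of products of `2 ^ m` elements of the ideal. -/
theorem elementary_foldl_mem_derivedSeries (N : Subgroup (QuasiGL R)) [N.Normal] (m : ℕ) :
    ∀ (a : levelIdeal N) (l : List (levelIdeal N)), l.length + 1 = 2 ^ m →
      ∀ (i j : Fin 3) (hij : i ≠ j) (h : elementary hij ((l.foldl (· * ·) a : levelIdeal N) : R) ∈ N),
        (⟨_, h⟩ : N) ∈ derivedSeries N m := by
  induction m with
  | zero => intros; simp
  | succ m ih =>
    intro a l hl i k hik h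
    obtain ⟨j, hij, hjk⟩ := exists_third i k
    -- The `2 ^ (m + 1)` factors, of which `a` is the first, split into halves, led by `a` and `b`.
    have hpos : 0 < 2 ^ m := by positivity
    have hlen : (l.drop (2 ^ m - 1)).length = 2 ^ m := by rw [List.length_drop]; omega
    obtain ⟨b, l₂, hb⟩ : ∃ b l₂, l.drop (2 ^ m - 1) = b :: l₂ :=
      List.exists_cons_of_length_pos (by omega)
    have hl₂ : l₂.length + 1 = 2 ^ m := by rw [← hlen, hb, List.length_cons]
    have hl₁ : (l.take (2 ^ m - 1)).length + 1 = 2 ^ m := by rw [List.length_take]; omega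
    have hfold : l.foldl (· * ·) a =
        (l.take (2 ^ m - 1)).foldl (· * ·) a * l₂.foldl (· * ·) b := by
      conv_lhs =>
        rw [← List.take_append_drop (2 ^ m - 1) l, hb, List.foldl_append, List.foldl_cons]
      exact List.foldl_assoc
    have h₁ := mem_levelIdeal.1 ((l.take (2 ^ m - 1)).foldl (· * ·) a).2 i j hij
    have h₂ := mem_levelIdeal.1 (l₂.foldl (· * ·) b).2 j k hjk
    have e : (⟨_, h⟩ : N) = ⁅(⟨_, h₁⟩ : N), (⟨_, h₂⟩ : N)⁆ := by
      refine Subtype.ext ?_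
      change elementary hik _ = ⁅elementary hij (_ : R), elementary hjk (_ : R)⁆
      rw [commutatorElement_elementary hij hjk hik, hfold]
      rfl
    rw [e]
    exact Subgroup.commutator_mem_commutator (ih _ _ hl₁ i j hij h₁) (ih _ _ hl₂ j k hjk h₂)

theorem elementary_eq_one {i j : Fin 3} (hij : i ≠ j) {a : R} (h : elementary hij a = 1) :
    a = 0 := by
  have := congrArg (fun u : QuasiGL R => u.val.val i j) h
  simpa [elementary] using this

/-- A normal solvable subgroup of finite index of `QuasiGL R` has as level ideal a nilpotent ideal of
finite index. -/
theorem isNilpotentByFiniteRing_of_quasiGL (h : IsSolvableByFinite (QuasiGL R)) :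
    IsNilpotentByFiniteRing R := by
  obtain ⟨N, hN, hfin, ⟨m, hm⟩⟩ := h
  refine ⟨levelIdeal N, ?_, 2 ^ m - 1, fun a l hl => ?_⟩
  · have : Finite (QuasiGL R ⧸ N) := Subgroup.finite_quotient_of_finiteIndex
    refine finite_quotient_of_map (F := ∀ i j : Fin 3, i ≠ j → QuasiGL R ⧸ N) _
      (fun a i j hij => (elementary hij a : QuasiGL R ⧸ N)) fun a b hab => ?_
    refine mem_levelIdeal.2 fun i j hij => ?_
    have := QuotientGroup.eq.1 (congrFun (congrFun (congrFun hab i) j) hij).symm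
    rwa [← elementary_neg, ← elementary_add, neg_add_eq_sub] at this
  · have hpos : 0 < 2 ^ m := by positivity
    have h01 : (0 : Fin 3) ≠ 1 := by decide
    have := elementary_foldl_mem_derivedSeries N m a l (by omega) 0 1 h01
      (mem_levelIdeal.1 (l.foldl (· * ·) a).2 0 1 h01)
    rw [hm, Subgroup.mem_bot] at this
    exact Subtype.ext (elementary_eq_one h01 (congrArg Subtype.val this))

end Elementary

/-! ### `*`-closed sets, groups and rings -/

theorem fixingSubgroup_le_stabilizer {G X Y : Type*} [Group G] [MulAction G X] [MulAction G Y]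
    {A : Set X} {D : Set Y} (h : ∀ g ∈ fixingSubgroup G A, ∀ d ∈ D, g • d ∈ D) :
    fixingSubgroup G A ≤ MulAction.stabilizer G D := by
  intro g hg
  refine MulAction.mem_stabilizer_iff.2 (Set.Subset.antisymm ?_ fun d hd => ?_)
  · rintro _ ⟨d, hd, rfl⟩
    exact h g hg d hd
  · exact Set.mem_smul_set_iff_inv_smul_mem.2 (h _ (inv_mem hg) d hd)

theorem smul_mem_of_fixing {G X Y : Type*} [Group G] [MulAction G X] [MulAction G Y]
    [TopologicalSpace Y] {A : Set X} {D : Set Y} (hD : IsClosedOver G A D) {g : G}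
    (hg : g ∈ fixingSubgroup G A) {d : Y} (hd : d ∈ D) : g • d ∈ D := by
  have := Set.smul_mem_smul_set (a := g) hd
  rwa [MulAction.mem_stabilizer_iff.1 (hD.2 hg)] at this

/-- Closed graph theorem for maps into a compact space: the preimage of a closed set is the
projection of a closed subset of the graph along the compact factor. -/
theorem continuous_of_isClosed_graph {S T : Type*} [TopologicalSpace S] [TopologicalSpace T]
    [CompactSpace T] {f : S → T} (h : IsClosed {p : S × T | f p.1 = p.2}) : Continuous f := by
  refine continuous_iff_isClosed.2 fun C hC => ?_
  have : f ⁻¹' C = Prod.fst '' ({p : S × T | f p.1 = p.2} ∩ Prod.snd ⁻¹' C) := by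
    ext s
    constructor
    · intro hs
      exact ⟨(s, f s), ⟨rfl, hs⟩, rfl⟩
    · rintro ⟨⟨s', t⟩, ⟨h1, h2⟩, rfl⟩
      change f s' ∈ C
      have h1 : f s' = t := h1
      rw [h1]
      exact h2
  rw [this]
  exact isClosedMap_fst_of_compactSpace _ (h.inter (hC.preimage continuous_snd))

/-- A binary operation on a compact set `R`, given by its closed graph, is continuous. -/
theorem continuous_of_isClosed_opGraph {Y : Type*} [TopologicalSpace Y] {R : Set Y}
    [CompactSpace R] (op : R → R → R)
    (h : IsClosed {p : Y × Y × Y | ∃ a b : R, p = ((a : Y), (b : Y), (op a b : Y))}) :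
    Continuous fun p : R × R => op p.1 p.2 := by
  refine continuous_of_isClosed_graph ?_
  convert h.preimage (f := fun q : (R × R) × R => ((q.1.1 : Y), (q.1.2 : Y), (q.2 : Y)))
    (by fun_prop) using 1
  ext ⟨⟨a, b⟩, c⟩
  constructor
  · intro hc
    exact ⟨a, b, by rw [← show op a b = c from hc]⟩
  · rintro ⟨a', b', h⟩
    simp only [Prod.mk.injEq, Subtype.coe_inj] at h
    obtain ⟨rfl, rfl, rfl⟩ := h
    rfl

/-- Elements fixing the parameters of a `*`-closed ring act on it by ring endomorphisms. -/
theorem IsStarClosedRing.exists_ringHom {X G Y : Type*} [Group G] [MulAction G X] [MulAction G Y]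
    [TopologicalSpace Y] {R : Set Y} [NonUnitalRing R] (h : IsStarClosedRing X G R) :
    ∃ A : Set X, A.Finite ∧
      ∀ g ∈ fixingSubgroup G A, ∃ σ : R →ₙ+* R, ∀ r, (σ r : Y) = g • (r : Y) := by
  obtain ⟨⟨A, hA, hR⟩, ⟨B, hB, hadd⟩, ⟨C, hC, hmul⟩⟩ := h
  refine ⟨A ∪ B ∪ C, (hA.union hB).union hC, fun g hg => ?_⟩
  have hfix : ∀ D ⊆ A ∪ B ∪ C, g ∈ fixingSubgroup G D := fun D hD =>
    fixingSubgroup_antitone G X hD hg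
  have hgA := hfix A fun x hx => Or.inl (Or.inl hx)
  have hgB := hfix B fun x hx => Or.inl (Or.inr hx)
  have hgC := hfix C fun x hx => Or.inr hx
  let s : R → R := fun r => ⟨g • (r : Y), smul_mem_of_fixing hR hgA r.2⟩
  have hs_mul : ∀ a b, s (a * b) = s a * s b := fun a b => by
    obtain ⟨a', b', e⟩ := smul_mem_of_fixing hmul hgC ⟨a, b, rfl⟩
    obtain ⟨e1, e2, e3⟩ : s a = a' ∧ s b = b' ∧ s (a * b) = a' * b' := by
      simpa [Prod.ext_iff, ← Subtype.coe_inj] using e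
    rw [e1, e2, e3]
  have hs_add : ∀ a b, s (a + b) = s a + s b := fun a b => by
    obtain ⟨a', b', e⟩ := smul_mem_of_fixing hadd hgB ⟨a, b, rfl⟩
    obtain ⟨e1, e2, e3⟩ : s a = a' ∧ s b = b' ∧ s (a + b) = a' + b' := by
      simpa [Prod.ext_iff, ← Subtype.coe_inj] using e
    rw [e1, e2, e3]
  exact ⟨{ toFun := s, map_mul' := hs_mul, map_add' := hs_add
           map_zero' := by simpa using hs_add 0 0 }, fun r => rfl⟩

/-- A compact group `K` embedded by `φ` in a Hausdorff space so that, over a finite set, `G` acts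
on the image through endomorphisms of `K`, is a `*`-closed group. -/
theorem exists_isStarClosedGroup_range {X G K Z : Type*} [Group G] [MulAction G X] [MulAction G Z]
    [TopologicalSpace Z] [T2Space Z] [Group K] [TopologicalSpace K] [CompactSpace K]
    [ContinuousMul K] {φ : K → Z} (hφ : Continuous φ) (hinj : Function.Injective φ) {A : Set X}
    (hA : A.Finite)
    (hσ : ∀ g ∈ fixingSubgroup G A, ∃ σ : K →* K, ∀ x, φ (σ x) = g • φ x) :
    ∃ _ : Group (Set.range φ), IsStarClosedGroup X G (Set.range φ) ∧
      Nonempty (K ≃* Set.range φ) := by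
  let e : K ≃ Set.range φ := Equiv.ofInjective φ hinj
  let inst : Group (Set.range φ) := e.symm.group
  have hmul : ∀ a b, e (a * b) = e a * e b := fun a b => (e.symm.mulEquiv.symm.map_mul a b)
  have hgraph : mulGraph (Set.range φ) =
      Set.range fun p : K × K => (φ p.1, φ p.2, φ (p.1 * p.2)) := by
    ext q
    constructor
    · rintro ⟨a, b, rfl⟩
      obtain ⟨a, rfl⟩ := e.surjective a
      obtain ⟨b, rfl⟩ := e.surjective b
      exact ⟨(a, b), by rw [← hmul]; rfl⟩
    · rintro ⟨⟨a, b⟩, rfl⟩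
      exact ⟨e a, e b, by rw [← hmul]; rfl⟩
  refine ⟨inst, ⟨⟨A, hA, ?_, ?_⟩, ⟨A, hA, ?_, ?_⟩⟩, ⟨e.symm.mulEquiv.symm⟩⟩
  · exact (isCompact_range hφ).isClosed
  · refine fixingSubgroup_le_stabilizer fun g hg => ?_
    obtain ⟨σ, hσ⟩ := hσ g hg
    rintro _ ⟨x, rfl⟩
    exact ⟨σ x, hσ x⟩
  · rw [hgraph]
    exact (isCompact_range (by fun_prop)).isClosed
  · rw [hgraph]
    refine fixingSubgroup_le_stabilizer fun g hg => ?_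
    obtain ⟨σ, hσ⟩ := hσ g hg
    rintro _ ⟨⟨x, y⟩, rfl⟩
    refine ⟨(σ x, σ y), ?_⟩
    simp only [← map_mul, hσ]
    rfl

theorem IsSolvableByFinite.of_mulEquiv {K H : Type*} [Group K] [Group H] (e : K ≃* H)
    (h : IsSolvableByFinite H) : IsSolvableByFinite K := by
  obtain ⟨N, hN, hfin, hs⟩ := h
  refine ⟨N.comap e.toMonoidHom, inferInstance,
    ⟨by rw [N.index_comap_of_surjective e.surjective]; exact hfin.index_ne_zero⟩, ?_⟩
  exact Group.isSolvable_of_isSolvable_injective (f := e.toMonoidHom.subgroupComap N)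
    fun a b hab => Subtype.ext (e.injective (congrArg Subtype.val hab))

theorem IsAbelianByFinite.of_mulEquiv {K H : Type*} [Group K] [Group H] (e : K ≃* H)
    (h : IsAbelianByFinite H) : IsAbelianByFinite K := by
  obtain ⟨N, hN, hfin, hs⟩ := h
  refine ⟨N.comap e.toMonoidHom, inferInstance,
    ⟨by rw [N.index_comap_of_surjective e.surjective]; exact hfin.index_ne_zero⟩,
    fun a b => Subtype.ext (e.injective ?_)⟩
  have : e a * e b = e b * e a := congrArg Subtype.val (hs ⟨e a, a.2⟩ ⟨e b, b.2⟩)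
  change e (a * b) = e (b * a)
  rwa [map_mul, map_mul]

/-! ### The groups attached to a `*`-closed ring -/

section Topology

variable {R : Type*} [TopologicalSpace R]

instance : TopologicalSpace (PreQuasiregular R) :=
  .induced PreQuasiregular.val inferInstance

/-- Wrapping in `PreQuasiregular` does not change the topology. -/
def preQuasiregularHomeomorph (R : Type*) [TopologicalSpace R] : PreQuasiregular R ≃ₜ R :=
  PreQuasiregular.equiv.symm.toHomeomorphOfIsInducing ⟨rfl⟩

instance [CompactSpace R] : CompactSpace (PreQuasiregular R) :=
  (preQuasiregularHomeomorph R).symm.compactSpace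

instance [T2Space R] : T2Space (PreQuasiregular R) :=
  (preQuasiregularHomeomorph R).symm.t2Space

theorem continuous_preQuasiregular_val : Continuous (PreQuasiregular.val : PreQuasiregular R → R) :=
  (preQuasiregularHomeomorph R).continuous

instance [NonUnitalRing R] [ContinuousAdd R] [ContinuousMul R] :
    ContinuousMul (PreQuasiregular R) where
  continuous_mul := by
    refine (preQuasiregularHomeomorph R).comp_continuous_iff.1 ?_
    have := continuous_preQuasiregular_val (R := R)
    change Continuous fun p : PreQuasiregular R × PreQuasiregular R =>
      p.2.val + p.1.val + p.1.val * p.2.val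
    fun_prop

/-- The coordinate bijection between the Heisenberg group and triples. -/
def Heisenberg.equiv (R : Type*) : Heisenberg R ≃ (Fin 3 → R) where
  toFun x := ![x.fst, x.snd, x.corner]
  invFun c := ⟨c 0, c 1, c 2⟩
  left_inv _ := rfl
  right_inv c := by ext i; fin_cases i <;> rfl

instance : TopologicalSpace (Heisenberg R) := .induced (Heisenberg.equiv R) inferInstance

/-- The Heisenberg group carries the product topology of its three coordinates, as in `Heisenberg.equiv`. -/
def Heisenberg.homeomorph (R : Type*) [TopologicalSpace R] : Heisenberg R ≃ₜ (Fin 3 → R) :=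
  (Heisenberg.equiv R).toHomeomorphOfIsInducing ⟨rfl⟩

instance [CompactSpace R] : CompactSpace (Heisenberg R) :=
  (Heisenberg.homeomorph R).symm.compactSpace

instance [NonUnitalRing R] [ContinuousAdd R] [ContinuousMul R] : ContinuousMul (Heisenberg R) where
  continuous_mul := by
    refine (Heisenberg.homeomorph R).comp_continuous_iff.1 (continuous_pi fun i => ?_)
    have h : ∀ i, Continuous fun x : Heisenberg R => Heisenberg.equiv R x i := fun i =>
      (continuous_apply i).comp (Heisenberg.homeomorph R).continuous
    have h0 : Continuous (Heisenberg.fst : Heisenberg R → R) := h 0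
    have h1 : Continuous (Heisenberg.snd : Heisenberg R → R) := h 1
    have h2 : Continuous (Heisenberg.corner : Heisenberg R → R) := h 2
    fin_cases i
    · change Continuous fun p : Heisenberg R × Heisenberg R => p.1.fst + p.2.fst
      fun_prop
    · change Continuous fun p : Heisenberg R × Heisenberg R => p.1.snd + p.2.snd
      fun_prop
    · change Continuous fun p : Heisenberg R × Heisenberg R =>
        p.1.corner + p.2.corner + p.1.fst * p.2.snd
      fun_prop

end Topology

/-- A ring endomorphism acts on the Heisenberg group entrywise. -/
def Heisenberg.map {R : Type*} [NonUnitalRing R] (f : R →ₙ+* R) : Heisenberg R →* Heisenberg R where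
  toFun x := ⟨f x.fst, f x.snd, f x.corner⟩
  map_one' := by simp [Heisenberg.one_def]
  map_mul' x y := by simp [Heisenberg.mul_def]

/-- A ring endomorphism acts on the quasiregular matrices entrywise. -/
def QuasiGL.map {R : Type*} [NonUnitalRing R] (f : R →ₙ+* R) : QuasiGL R →* QuasiGL R :=
  Units.map
    { toFun := fun x => ⟨x.val.map f⟩
      map_one' := preQuasiregular_ext (by ext; simp)
      map_mul' := fun x y => preQuasiregular_ext (by ext; simp [Matrix.mul_apply]) }

section Core

variable {X G Y Z : Type*} [Group G] [MulAction G X] [MulAction G Y] [MulAction G Z]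
  [TopologicalSpace Y] [CompactSpace Y] [TopologicalSpace Z] [T2Space Z]
  {R : Set Y} [NonUnitalRing R]

theorem IsStarClosedRing.compactSpace (h : IsStarClosedRing X G R) : CompactSpace R :=
  isCompact_iff_compactSpace.1 h.1.choose_spec.2.1.isCompact

theorem IsStarClosedRing.continuousAdd (h : IsStarClosedRing X G R) : ContinuousAdd R :=
  have := h.compactSpace
  ⟨continuous_of_isClosed_opGraph (· + ·) h.2.1.choose_spec.2.1⟩

theorem IsStarClosedRing.continuousMul (h : IsStarClosedRing X G R) : ContinuousMul R :=
  have := h.compactSpace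
  ⟨continuous_of_isClosed_opGraph (· * ·) h.2.2.choose_spec.2.1⟩

/-- The case of a ring in `Y` when the ninth power of `Y` embeds equivariantly in a space `Z` whose
`*`-closed groups are solvable-by-finite. -/
theorem IsStarClosedRing.isNilpotentByFiniteRing [T2Space Y] (h : IsStarClosedRing X G R)
    {φ : (Fin (3 * 3) → Y) → Z} (hφ : Continuous φ) (hinj : Function.Injective φ)
    (hsmul : ∀ (g : G) c, φ (g • c) = g • φ c)
    (hZ : ∀ (H : Set Z) [Group H], IsStarClosedGroup X G H → IsSolvableByFinite H) :
    IsNilpotentByFiniteRing R := by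
  have := h.compactSpace
  have := h.continuousAdd
  have := h.continuousMul
  obtain ⟨A, hA, hσ⟩ := h.exists_ringHom
  let ψ : QuasiGL R → Fin (3 * 3) → Y := fun u m =>
    (u.val.val (finProdFinEquiv.symm m).1 (finProdFinEquiv.symm m).2 : R)
  have hψ : Continuous ψ := by
    refine continuous_pi fun m => continuous_subtype_val.comp ?_
    exact (continuous_preQuasiregular_val.comp Units.continuous_val).matrix_elem _ _
  have hψinj : Function.Injective ψ := fun u v huv => quasiGL_ext <| by
    ext i j
    simpa [ψ] using congrFun huv (finProdFinEquiv (i, j))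
  have : CompactSpace (Matrix (Fin 3) (Fin 3) R) := Pi.compactSpace
  have : T2Space (Matrix (Fin 3) (Fin 3) R) := Pi.t2Space
  obtain ⟨inst, hH, ⟨e⟩⟩ := exists_isStarClosedGroup_range (G := G) (hφ.comp hψ)
    (hinj.comp hψinj) hA fun g hg => by
      obtain ⟨σ, hσ⟩ := hσ g hg
      refine ⟨QuasiGL.map σ, fun u => ?_⟩
      rw [Function.comp_apply, Function.comp_apply, ← hsmul]
      exact congrArg φ (funext fun m => hσ _)
  exact isNilpotentByFiniteRing_of_quasiGL ((hZ _ hH).of_mulEquiv e)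

/-- The case of a ring in `Y` when the cube of `Y` embeds equivariantly in a space `Z` whose
nilpotent `*`-closed groups are abelian-by-finite. -/
theorem IsStarClosedRing.isNullByFiniteRing (h : IsStarClosedRing X G R)
    {φ : (Fin 3 → Y) → Z} (hφ : Continuous φ) (hinj : Function.Injective φ)
    (hsmul : ∀ (g : G) c, φ (g • c) = g • φ c)
    (hZ : ∀ (H : Set Z) [Group H], IsStarClosedGroup X G H → Group.IsNilpotent H →
      IsAbelianByFinite H) :
    IsNullByFiniteRing R := by
  have := h.compactSpace
  have := h.continuousAdd
  have := h.continuousMul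
  obtain ⟨A, hA, hσ⟩ := h.exists_ringHom
  let ψ : Heisenberg R → Fin 3 → Y := fun u m => (Heisenberg.equiv R u m : R)
  have hψ : Continuous ψ := continuous_pi fun m => continuous_subtype_val.comp
    ((continuous_apply m).comp (Heisenberg.homeomorph R).continuous)
  have hψinj : Function.Injective ψ := fun u v huv => (Heisenberg.equiv R).injective <|
    funext fun m => Subtype.ext (congrFun huv m)
  obtain ⟨inst, hH, ⟨e⟩⟩ := exists_isStarClosedGroup_range (G := G) (hφ.comp hψ)
    (hinj.comp hψinj) hA fun g hg => by
      obtain ⟨σ, hσ⟩ := hσ g hg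
      refine ⟨Heisenberg.map σ, fun u => ?_⟩
      rw [Function.comp_apply, Function.comp_apply, ← hsmul]
      refine congrArg φ (funext fun m => ?_)
      fin_cases m <;> exact hσ _
  have hnil : Group.IsNilpotent (Heisenberg R) := Heisenberg.isNilpotent
  exact Heisenberg.isNullByFiniteRing
    ((hZ _ hH (Group.nilpotent_of_mulEquiv e)).of_mulEquiv e)

end Core

/-! ### Powers of topological sorts -/

section Sorts

variable {X G : Type*} [TopologicalSpace X] [Group G] [MulAction G X] {n : ℕ}

theorem TopSort.isQuotientMap_mk (E : ClosedEquiv X G n) :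
    Topology.IsQuotientMap (Quotient.mk E.rel : (Fin n → X) → TopSort E) :=
  isQuotientMap_quotient_mk'

/-- A closed equivalence relation on a compact Hausdorff space has a Hausdorff quotient: the
quotient map is closed, so normality of the space passes to the quotient. -/
theorem TopSort.t2Space [CompactSpace X] [T2Space X] (E : ClosedEquiv X G n) :
    T2Space (TopSort E) := by
  let q : (Fin n → X) → TopSort E := Quotient.mk E.rel
  have hq : Topology.IsQuotientMap q := TopSort.isQuotientMap_mk E
  have hqe : ∀ a b, q a = q b ↔ E.rel a b := fun a b => Quotient.eq (r := E.rel)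
  have hclosed : IsClosedMap q := by
    intro C hC
    refine hq.isClosed_preimage.1 ?_
    have : q ⁻¹' (q '' C) = Prod.snd ''
        ({p : (Fin n → X) × (Fin n → X) | E.rel p.1 p.2} ∩ Prod.fst ⁻¹' C) := by
      ext b
      constructor
      · rintro ⟨a, ha, hab⟩
        exact ⟨(a, b), ⟨(hqe a b).1 hab, ha⟩, rfl⟩
      · rintro ⟨⟨a, b⟩, ⟨hab, ha⟩, rfl⟩
        exact ⟨a, ha, (hqe a b).2 hab⟩
    rw [this]
    exact isClosedMap_snd_of_compactSpace _ (E.closed.1.inter (hC.preimage continuous_fst))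
  have hpt : ∀ y : TopSort E, IsClosed (q ⁻¹' {y}) := fun y => by
    obtain ⟨a, rfl⟩ := hq.surjective y
    rw [← Set.image_singleton]
    exact (hclosed _ isClosed_singleton).preimage hq.continuous
  refine ⟨fun x y hxy => ?_⟩
  obtain ⟨U, V, hU, hV, hxU, hyV, hUV⟩ := normal_separation (hpt x) (hpt y)
    (Set.disjoint_singleton.2 hxy |>.preimage q)
  refine ⟨(q '' Uᶜ)ᶜ, (q '' Vᶜ)ᶜ, (hclosed _ hU.isClosed_compl).isOpen_compl,
    (hclosed _ hV.isClosed_compl).isOpen_compl, ?_, ?_, ?_⟩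
  · rintro ⟨a, ha, rfl⟩
    exact ha (hxU rfl)
  · rintro ⟨a, ha, rfl⟩
    exact ha (hyV rfl)
  · refine Set.disjoint_left.2 fun z hzU hzV => ?_
    obtain ⟨a, rfl⟩ := hq.surjective z
    by_cases ha : a ∈ U
    · exact hzV ⟨a, Set.disjoint_left.1 hUV ha, rfl⟩
    · exact hzU ⟨a, ha, rfl⟩

instance TopSort.compactSpace [CompactSpace X] (E : ClosedEquiv X G n) : CompactSpace (TopSort E) :=
  inferInstanceAs (CompactSpace (Quotient E.rel))

/-- The `i`-th of the `k` blocks of length `n` of a tuple of length `k * n`. -/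
def block {k : ℕ} (i : Fin k) (a : Fin (k * n) → X) : Fin n → X := fun j =>
  a (finProdFinEquiv (i, j))

/-- The blockwise equivalence relation on `X ^ (k * n)`, whose sort is the `k`-th power of the
sort of `E`. -/
def ClosedEquiv.pow (E : ClosedEquiv X G n) (k : ℕ) : ClosedEquiv X G (k * n) where
  rel :=
    { r := fun a b => ∀ i : Fin k, E.rel (block i a) (block i b)
      iseqv := ⟨fun _ _ => E.rel.refl _, fun h i => E.rel.symm (h i),
        fun h h' i => E.rel.trans (h i) (h' i)⟩ }
  closed := by
    constructor
    · change IsClosed {p : (Fin (k * n) → X) × (Fin (k * n) → X) |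
        ∀ i : Fin k, E.rel (block i p.1) (block i p.2)}
      rw [Set.ofPred_forall]
      refine isClosed_iInter fun i => E.closed.1.preimage
        (f := fun p : (Fin (k * n) → X) × (Fin (k * n) → X) => (block i p.1, block i p.2)) ?_
      unfold block
      fun_prop
    · exact fixingSubgroup_le_stabilizer fun g _ p hp i =>
        E.smul_rel g ((show ∀ i, E.rel (block i p.1) (block i p.2) from hp) i)

/-- The blocks of a class of the power relation, as classes of `E`. -/
def TopSort.blocks (E : ClosedEquiv X G n) (k : ℕ) (z : TopSort (E.pow k)) : Fin k → TopSort E :=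
  fun i => Quotient.map (block i) (fun a b h =>
    (show ∀ i, E.rel (block i a) (block i b) from h) i) z

theorem TopSort.bijective_blocks (E : ClosedEquiv X G n) (k : ℕ) :
    Function.Bijective (TopSort.blocks E k) := by
  constructor
  · intro z w h
    induction z using Quotient.inductionOn with | h a => ?_
    induction w using Quotient.inductionOn with | h b => ?_
    exact Quotient.sound fun i => Quotient.exact (congrFun h i)
  · intro c
    refine ⟨Quotient.mk (E.pow k).rel fun m =>
      (c (finProdFinEquiv.symm m).1).out (finProdFinEquiv.symm m).2, funext fun i => ?_⟩
    refine Eq.trans ?_ (Quotient.out_eq (c i))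
    refine congrArg (Quotient.mk E.rel) (funext fun j => ?_)
    simp [block]

theorem TopSort.blocks_smul (E : ClosedEquiv X G n) (k : ℕ) (g : G) (z : TopSort (E.pow k)) :
    TopSort.blocks E k (g • z) = g • TopSort.blocks E k z := by
  induction z using Quotient.inductionOn with | h a => rfl

theorem TopSort.continuous_blocks (E : ClosedEquiv X G n) (k : ℕ) :
    Continuous (TopSort.blocks E k) := by
  refine continuous_pi fun i => (TopSort.isQuotientMap_mk (E.pow k)).continuous_iff.2 ?_
  refine (TopSort.isQuotientMap_mk E).continuous.comp (g := Quotient.mk E.rel) (f := block i) ?_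
  unfold block
  fun_prop

/-- Powers of a sort embed in a single sort. The inverse of the embedding is a continuous bijection
from a compact space to a Hausdorff space. -/
theorem TopSort.exists_pow_embedding [CompactSpace X] [T2Space X] (E : ClosedEquiv X G n) (k : ℕ) :
    ∃ φ : (Fin k → TopSort E) → TopSort (E.pow k), Continuous φ ∧ Function.Injective φ ∧
      ∀ (g : G) c, φ (g • c) = g • φ c := by
  have := TopSort.t2Space E
  let e := Equiv.ofBijective _ (TopSort.bijective_blocks E k)
  refine ⟨e.symm, ?_, e.symm.injective, fun g c => ?_⟩
  · exact (TopSort.continuous_blocks E k).continuous_symm_of_equiv_compact_to_t2 (f := e)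
  · refine e.injective ?_
    change _ = TopSort.blocks E k (g • e.symm c)
    rw [TopSort.blocks_smul, e.apply_symm_apply]
    exact congrArg (g • ·) (e.apply_symm_apply c).symm

/-- Powers of `X ^ n` embed in a single power of `X`. -/
theorem exists_pow_embedding (k n : ℕ) :
    ∃ φ : (Fin k → Fin n → X) → Fin (k * n) → X, Continuous φ ∧ Function.Injective φ ∧
      ∀ (g : G) c, φ (g • c) = g • φ c := by
  refine ⟨fun c m => c (finProdFinEquiv.symm m).1 (finProdFinEquiv.symm m).2, by fun_prop,
    fun c d h => ?_, fun g c => rfl⟩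
  ext i j
  simpa using congrFun h (finProdFinEquiv (i, j))

end Sorts

end ProfStr

/-- For a small profinite structure `(X, G)`: the first two conjuncts are the claims about
solvable-by-finite groups, in `X` and in `X^teq`; the last two are the claims about
abelian-by-finite nilpotent groups, in `X` and in `X^teq`. -/
theorem mainTheorem9 {X G : Type*} [TopologicalSpace X] [Group G] [TopologicalSpace G]
    [MulAction G X] [ProfStr.ProfiniteStructure X G] (hsmall : ProfStr.IsSmall X G) :
    ((∀ (n : ℕ) (H : Set (Fin n → X)) [Group H],
        ProfStr.IsStarClosedGroup X G H → ProfStr.IsSolvableByFinite H) →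
      ∀ (n : ℕ) (R : Set (Fin n → X)) [NonUnitalRing R],
        ProfStr.IsStarClosedRing X G R → ProfStr.IsNilpotentByFiniteRing R) ∧
    ((∀ (n : ℕ) (E : ProfStr.ClosedEquiv X G n) (H : Set (ProfStr.TopSort E)) [Group H],
        ProfStr.IsStarClosedGroup X G H → ProfStr.IsSolvableByFinite H) →
      ∀ (n : ℕ) (E : ProfStr.ClosedEquiv X G n) (R : Set (ProfStr.TopSort E)) [NonUnitalRing R],
        ProfStr.IsStarClosedRing X G R → ProfStr.IsNilpotentByFiniteRing R) ∧
    ((∀ (n : ℕ) (H : Set (Fin n → X)) [Group H],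
        ProfStr.IsStarClosedGroup X G H → Group.IsNilpotent H → ProfStr.IsAbelianByFinite H) →
      ∀ (n : ℕ) (R : Set (Fin n → X)) [NonUnitalRing R],
        ProfStr.IsStarClosedRing X G R → ProfStr.IsNullByFiniteRing R) ∧
    ((∀ (n : ℕ) (E : ProfStr.ClosedEquiv X G n) (H : Set (ProfStr.TopSort E)) [Group H],
        ProfStr.IsStarClosedGroup X G H → Group.IsNilpotent H → ProfStr.IsAbelianByFinite H) →
      ∀ (n : ℕ) (E : ProfStr.ClosedEquiv X G n) (R : Set (ProfStr.TopSort E)) [NonUnitalRing R],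
        ProfStr.IsStarClosedRing X G R → ProfStr.IsNullByFiniteRing R) := by
  obtain ⟨_, _, -, -, -, -, -, -, -⟩ := ‹ProfStr.ProfiniteStructure X G›
  refine ⟨fun hyp n R _ hR => ?_, fun hyp n E R _ hR => ?_, fun hyp n R _ hR => ?_,
    fun hyp n E R _ hR => ?_⟩
  · obtain ⟨φ, hφ, hinj, hsmul⟩ := ProfStr.exists_pow_embedding (X := X) (G := G) (3 * 3) n
    exact hR.isNilpotentByFiniteRing hφ hinj hsmul (hyp _)
  · obtain ⟨φ, hφ, hinj, hsmul⟩ := ProfStr.TopSort.exists_pow_embedding E (3 * 3)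
    have := ProfStr.TopSort.t2Space E
    have := ProfStr.TopSort.t2Space (E.pow (3 * 3))
    exact hR.isNilpotentByFiniteRing hφ hinj hsmul (hyp _ _)
  · obtain ⟨φ, hφ, hinj, hsmul⟩ := ProfStr.exists_pow_embedding (X := X) (G := G) 3 n
    exact hR.isNullByFiniteRing hφ hinj hsmul (hyp _)
  · obtain ⟨φ, hφ, hinj, hsmul⟩ := ProfStr.TopSort.exists_pow_embedding E 3
    have := ProfStr.TopSort.t2Space (E.pow 3)
    exact hR.isNullByFiniteRing hφ hinj hsmul (hyp _ _)
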